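/- Notation. Let $R$ be a commutative ring. For $r \in R$ put $T(r) = \begin{pmatrix} 1 & r \\ 0 & 1 \end{pmatrix} \in SL_2(R)$. Let $H$ be a subgroup of $SL_2(R)$. The level $l(H)$ of $H$ is the largest ideal $\mathfrak{q}$ of $R$ such that $H$ contains the normal subgroup of $SL_2(R)$ generated by all $T(q)$ with $q \in \mathfrak{q}$. The quasi-level of $H$ is the additive subgroup $$ql(H) = \bigcap_{g \in SL_2(R)} \{ r \in R : g\,T(r)\,g^{-1} \in H \}$$ of $R$. The subgroup $H$ is a congruence subgroup if, for some nonzero ideal $\mathfrak{q}$ of $R$, it contains $\{X \in SL_2(R) : X \equiv I_2 \pmod{\mathfrak{q}}\}$, and it is a non-congruence subgroup otherwise. Theorem 4.12. Let $k$ be any field and let $f \in k[t]$ with $\deg(f) \ge 2$. Suppose that $f(0) \ne 0$ and, further, that $f'(0) \neq 0$ when $\deg(f) = 2$. Then there exists a normal non-congruence subgroup $N$ of $SL_2(k[t])$ with the following properties: (i) $N \cdot SL_2(k) = SL_2(k[t])$; (ii) $l(N) = (f)$; (iii) $ql(N)$ is a $k$-subspace of $k[t]$ of codimension $1$. -/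

import Mathlib

open Polynomial
open scoped Pointwise MatrixGroups

namespace SL2Level

/-- The translation matrix `T(r) = (1 r; 0 1)` in `SL₂(R)`. -/
def T {R : Type*} [CommRing R] (r : R) : SL(2, R) :=
  ⟨!![1, r; 0, 1], by simp [Matrix.det_fin_two]⟩

/-- `NE₂(R, 𝔮)`: the normal subgroup of `SL₂(R)` generated by all `T(q)` with `q ∈ 𝔮`. -/
def NE2 {R : Type*} [CommRing R] (q : Ideal R) : Subgroup SL(2, R) :=
  Subgroup.normalClosure (T '' (q : Set R))

/-- The principal congruence subgroup `SL₂(R, 𝔮) = {X : X ≡ I₂ mod 𝔮}`. -/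
def principal {R : Type*} [CommRing R] (q : Ideal R) : Subgroup SL(2, R) :=
  (Matrix.SpecialLinearGroup.map (n := Fin 2) (Ideal.Quotient.mk q)).ker

/-- A congruence subgroup of `SL₂(R)` is one that contains `SL₂(R, 𝔮)` for some nonzero
ideal `𝔮`. -/
def IsCongruence {R : Type*} [CommRing R] (H : Subgroup SL(2, R)) : Prop :=
  ∃ q : Ideal R, q ≠ ⊥ ∧ principal q ≤ H

/-- The level `l(H)`: the largest ideal `𝔮` with `NE₂(R, 𝔮) ≤ H`, written as the supremum of
all such ideals; `level_isGreatest` shows that it is itself such an ideal. -/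
noncomputable def level {R : Type*} [CommRing R] (H : Subgroup SL(2, R)) : Ideal R :=
  sSup {q : Ideal R | NE2 q ≤ H}

theorem T_zero {R : Type*} [CommRing R] : T (0 : R) = 1 := by
  ext i j
  fin_cases i <;> fin_cases j <;> simp [T]

theorem T_add {R : Type*} [CommRing R] (a b : R) : T (a + b) = T a * T b := by
  apply Subtype.ext
  rw [Matrix.SpecialLinearGroup.coe_mul]
  simp [T, add_comm]

theorem T_neg {R : Type*} [CommRing R] (a : R) : T (-a) = (T a)⁻¹ := by
  rw [eq_inv_iff_mul_eq_one, ← T_add, neg_add_cancel, T_zero]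

theorem NE2_le_iff {R : Type*} [CommRing R] (q : Ideal R) (H : Subgroup SL(2, R)) :
    NE2 q ≤ H ↔ ∀ r ∈ q, T r ∈ H.normalCore := by
  constructor
  · intro h r hr
    have : (NE2 q).Normal := Subgroup.normalClosure_normal
    exact Subgroup.normal_le_normalCore.2 h
      (Subgroup.subset_normalClosure (Set.mem_image_of_mem T hr))
  · intro h
    refine le_trans (Subgroup.normalClosure_le_normal ?_) (Subgroup.normalCore_le H)
    rintro _ ⟨r, hr, rfl⟩
    exact h r hr

theorem level_isGreatest {R : Type*} [CommRing R] (H : Subgroup SL(2, R)) :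
    IsGreatest {q : Ideal R | NE2 q ≤ H} (level H) := by
  refine ⟨?_, fun q hq => le_sSup hq⟩
  rw [Set.mem_ofPred_eq, NE2_le_iff]
  intro r hr
  rw [level, sSup_eq_iSup'] at hr
  induction hr using Submodule.iSup_induction' with
  | mem i x hx => exact (NE2_le_iff i.1 H).1 i.2 x hx
  | zero => rw [T_zero]; exact one_mem _
  | add x y _ _ hx hy => rw [T_add]; exact mul_mem hx hy

/-- The quasi-amplitude `𝔟(H, g) = {r ∈ R : T(r) ∈ g⁻¹ H g}`, an additive subgroup of `R`.
Note that `T(r) ∈ g⁻¹ H g` means `g T(r) g⁻¹ ∈ H`. -/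
def quasiAmplitude {R : Type*} [CommRing R] (H : Subgroup SL(2, R)) (g : SL(2, R)) :
    AddSubgroup R where
  carrier := {r : R | g * T r * g⁻¹ ∈ H}
  zero_mem' := by
    have : g * T (0 : R) * g⁻¹ = 1 := by rw [T_zero]; group
    rw [Set.mem_ofPred_eq, this]; exact one_mem H
  add_mem' := by
    intro a b ha hb
    have : g * T (a + b) * g⁻¹ = (g * T a * g⁻¹) * (g * T b * g⁻¹) := by rw [T_add]; group
    rw [Set.mem_ofPred_eq, this]; exact mul_mem ha hb
  neg_mem' := by
    intro a ha
    have : g * T (-a) * g⁻¹ = (g * T a * g⁻¹)⁻¹ := by rw [T_neg]; group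
    rw [Set.mem_ofPred_eq, this]; exact inv_mem ha

/-- The quasi-level `ql(H) = ⋂_g 𝔟(H, g)`, an additive subgroup of `R`. -/
def quasiLevel {R : Type*} [CommRing R] (H : Subgroup SL(2, R)) : AddSubgroup R :=
  ⨅ g : SL(2, R), quasiAmplitude H g

/-- The subgroup `SL₂(k)` of `SL₂(k[t])`: the matrices with constant entries. -/
noncomputable def constSL2 (k : Type*) [Field k] : Subgroup SL(2, k[X]) :=
  (Matrix.SpecialLinearGroup.map (n := Fin 2) (C : k →+* k[X])).range

end SL2Level

/-! By Nagao's theorem `SL₂(k[t])` is the amalgam of `SL₂(k)` and the upper triangular group over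
their intersection. A linear `l : k[t] → k` with `l 1 = 1` therefore gives a retraction onto
`SL₂(k)` sending `T r` to `T (l r)`; here it is built directly from the Euclidean algorithm
(`retract`, `retract_mul`). Its kernel `N` is normal, is complemented by `SL₂(k)`, and contains `T
r` iff `l r = 0`. So the quasi-level is `ker l` and the level is the largest ideal inside `ker l`,
which `exists_functional` arranges to be `(f)`.

If `N` contained the congruence subgroup of a nonzero `𝔮`, every unit `v` modulo `𝔮` would satisfy
`l (v² r) = l(v)² l(r)` (`functional_sq_mul`), whence `f ∣ v² - l(v)²`. Taking `v ≡ t` mod `f`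
(`exists_isCoprime_add_mul`) gives `f ∣ t² - c²` with `c ∈ k`. Then `f` is a scalar multiple of `t²
- c²`, so `deg f = 2` and `f'(0) = 0`, which is excluded. -/

namespace SL2Level

open Matrix

/-- The Weyl element `(0 1; -1 0)` of `SL₂(R)`. -/
def weyl (R : Type*) [CommRing R] : SL(2, R) :=
  ⟨!![0, 1; -1, 0], by simp [Matrix.det_fin_two]⟩

/-- The diagonal matrix `(u 0; 0 u⁻¹)`. -/
def diag {R : Type*} [CommRing R] (u : Rˣ) : SL(2, R) :=
  ⟨!![(u : R), 0; 0, ((u⁻¹ : Rˣ) : R)], by simp [Matrix.det_fin_two]⟩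

/-- The upper triangular matrix `(a b; 0 d)`. -/
def upper {R : Type*} [CommRing R] (a b d : R) (h : a * d = 1) : SL(2, R) :=
  ⟨!![a, b; 0, d], by simpa [Matrix.det_fin_two] using h⟩

/-- The lower unipotent matrix `(1 0; r 1)`. -/
def U {R : Type*} [CommRing R] (r : R) : SL(2, R) :=
  ⟨!![1, 0; r, 1], by simp [Matrix.det_fin_two]⟩

/-! ### Relations among elementary matrices. -/

section Identities

variable {R : Type*} [CommRing R]

theorem sl_ext {A B : SL(2, R)} (h00 : A 0 0 = B 0 0) (h01 : A 0 1 = B 0 1)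
    (h10 : A 1 0 = B 1 0) (h11 : A 1 1 = B 1 1) : A = B := by
  ext i j
  fin_cases i <;> fin_cases j <;> assumption

theorem mul_apply_two (A B : SL(2, R)) (i j : Fin 2) :
    (A * B) i j = A i 0 * B 0 j + A i 1 * B 1 j := by
  rw [Matrix.SpecialLinearGroup.coe_mul, Matrix.mul_apply, Fin.sum_univ_two]

@[simp] theorem T_00 (r : R) : T r 0 0 = 1 := rfl
@[simp] theorem T_01 (r : R) : T r 0 1 = r := rfl
@[simp] theorem T_10 (r : R) : T r 1 0 = 0 := rfl
@[simp] theorem T_11 (r : R) : T r 1 1 = 1 := rfl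
@[simp] theorem weyl_00 : weyl R 0 0 = 0 := rfl
@[simp] theorem weyl_01 : weyl R 0 1 = 1 := rfl
@[simp] theorem weyl_10 : weyl R 1 0 = -1 := rfl
@[simp] theorem weyl_11 : weyl R 1 1 = 0 := rfl
@[simp] theorem diag_00 (u : Rˣ) : diag u 0 0 = u := rfl
@[simp] theorem diag_01 (u : Rˣ) : diag u 0 1 = 0 := rfl
@[simp] theorem diag_10 (u : Rˣ) : diag u 1 0 = 0 := rfl
@[simp] theorem diag_11 (u : Rˣ) : diag u 1 1 = (u⁻¹ : Rˣ) := rfl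

@[simp] theorem upper_00 (a b d : R) (h : a * d = 1) : upper a b d h 0 0 = a := rfl
@[simp] theorem upper_01 (a b d : R) (h : a * d = 1) : upper a b d h 0 1 = b := rfl
@[simp] theorem upper_10 (a b d : R) (h : a * d = 1) : upper a b d h 1 0 = 0 := rfl
@[simp] theorem upper_11 (a b d : R) (h : a * d = 1) : upper a b d h 1 1 = d := rfl
@[simp] theorem U_00 (r : R) : U r 0 0 = 1 := rfl
@[simp] theorem U_01 (r : R) : U r 0 1 = 0 := rfl
@[simp] theorem U_10 (r : R) : U r 1 0 = r := rfl
@[simp] theorem U_11 (r : R) : U r 1 1 = 1 := rfl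

theorem weyl_mul_weyl : weyl R * weyl R = diag (-1) := by
  apply sl_ext <;> simp [mul_apply_two]

theorem weyl_inv_eq : (weyl R)⁻¹ = weyl R * diag (-1) := by
  rw [inv_eq_iff_mul_eq_one]
  apply sl_ext <;> simp [mul_apply_two]

theorem weyl_inv_mul_diag : (weyl R)⁻¹ * diag (-1) = weyl R := by
  rw [← weyl_mul_weyl, inv_mul_cancel_left]

theorem diag_mul_T (u : Rˣ) (r : R) : diag u * T r = T (u * u * r) * diag u := by
  apply sl_ext <;> simp [mul_apply_two]
  linear_combination (-(u : R) * r) * u.mul_inv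

theorem diag_mul_weyl_inv (u : Rˣ) : diag u * (weyl R)⁻¹ = (weyl R)⁻¹ * diag u⁻¹ := by
  rw [weyl_inv_eq]
  apply sl_ext <;> simp [mul_apply_two]

theorem weyl_mul_diag (u : Rˣ) : weyl R * diag u = diag u⁻¹ * weyl R := by
  apply sl_ext <;> simp [mul_apply_two]

/-- The Bruhat decomposition of a nontrivial lower unipotent matrix, times `weyl`. -/
theorem weyl_mul_T (u : Rˣ) :
    weyl R * T (u : R) =
      T (-((u⁻¹ : Rˣ) : R)) * (diag u⁻¹ * (weyl R * (T (-((u⁻¹ : Rˣ) : R)) * weyl R))) := by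
  apply sl_ext <;> simp [mul_apply_two]

theorem weyl_mul_T_mul_10 (q : R) (g : SL(2, R)) :
    (weyl R * T (-q) * g) 1 0 = -(g 0 0 - q * g 1 0) := by
  simp [mul_apply_two]
  ring

end Identities

/-! ### The retraction onto `SL₂(k)`. -/

section Retract

variable {k : Type*} [Field k]

theorem degree_weyl_mul_T_mul_lt (g : SL(2, k[X])) (h : g 1 0 ≠ 0) :
    ((weyl k[X] * T (-(g 0 0 / g 1 0)) * g) 1 0).degree < (g 1 0).degree := by
  rw [weyl_mul_T_mul_10, degree_neg, mul_comm, ← EuclideanDomain.mod_eq_sub_mul_div]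
  exact degree_mod_lt _ h

theorem eval_diag_mul (g : SL(2, k[X])) (h : g 1 0 = 0) :
    (g 0 0).eval 0 * (g 1 1).eval 0 = 1 := by
  have := g.det_coe
  rw [Matrix.det_fin_two, h, mul_zero, sub_zero] at this
  rw [← eval_mul, this, eval_one]

/-- The retraction `SL₂(k[t]) → SL₂(k)` with `T(r) ↦ T(l(r))`, computed by running the Euclidean
algorithm on the first column. -/
noncomputable def retract (l : k[X] →ₗ[k] k) (g : SL(2, k[X])) : SL(2, k) :=
  open Classical in
  if h : g 1 0 = 0 then
    -- The diagonal entries are units of `k[t]`, hence constants; evaluation at 0 only reads them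
    -- off.
    upper ((g 0 0).eval 0) (l (g 0 1)) ((g 1 1).eval 0) (eval_diag_mul g h)
  else
    T (l (g 0 0 / g 1 0)) * (weyl k)⁻¹ * retract l (weyl k[X] * T (-(g 0 0 / g 1 0)) * g)
termination_by (g 1 0).degree
decreasing_by exact degree_weyl_mul_T_mul_lt g h

variable (l : k[X] →ₗ[k] k)

theorem retract_of_eq (g : SL(2, k[X])) (h : g 1 0 = 0) :
    retract l g = upper ((g 0 0).eval 0) (l (g 0 1)) ((g 1 1).eval 0) (eval_diag_mul g h) := by
  rw [retract]
  exact dif_pos h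

theorem retract_of_ne (g : SL(2, k[X])) (h : g 1 0 ≠ 0) :
    retract l g = T (l (g 0 0 / g 1 0)) * (weyl k)⁻¹ *
      retract l (weyl k[X] * T (-(g 0 0 / g 1 0)) * g) := by
  rw [retract]
  exact dif_neg h

theorem euclid_induction {P : SL(2, k[X]) → Prop} (h0 : ∀ g, g 1 0 = 0 → P g)
    (h1 : ∀ g, g 1 0 ≠ 0 → P (weyl k[X] * T (-(g 0 0 / g 1 0)) * g) → P g) (g : SL(2, k[X])) :
    P g := by
  by_cases h : g 1 0 = 0
  · exact h0 g h
  · exact h1 g h (euclid_induction h0 h1 _)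
termination_by (g 1 0).degree
decreasing_by exact degree_weyl_mul_T_mul_lt g h

theorem exists_C_of_lower_eq_zero (g : SL(2, k[X])) (h : g 1 0 = 0) :
    ∃ u : kˣ, g = diag (Units.map (C : k →+* k[X]).toMonoidHom u) *
      T (C ((u⁻¹ : kˣ) : k) * g 0 1) := by
  have hd := g.det_coe
  rw [Matrix.det_fin_two, h, mul_zero, sub_zero] at hd
  obtain ⟨a, ha, hC⟩ := Polynomial.isUnit_iff.1 (IsUnit.of_mul_eq_one _ hd)
  obtain ⟨u, rfl⟩ := ha
  have hu : C (u : k) * C ((u⁻¹ : kˣ) : k) = 1 := by rw [← C_mul, u.mul_inv, C_1]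
  rw [Units.val_inv_eq_inv_val] at hu
  refine ⟨u, sl_ext ?_ ?_ ?_ ?_⟩ <;> simp [mul_apply_two, h, hC, ← map_inv]
  · rw [← hC]
    linear_combination (-(g 0 1)) * hu
  · rw [← hC] at hd
    linear_combination (C ((u : k)⁻¹)) * hd - (g 1 1) * hu

/-- Uniqueness of Euclidean division, used to follow the quotient in `retract` under row operations.
-/
theorem div_eq_of_eq_mul_add {a c q r : k[X]} (hc : c ≠ 0) (h : a = c * q + r)
    (hr : r.degree < c.degree) : a / c = q := by
  have h' : c * (q - a / c) = a % c - r := by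
    linear_combination -(EuclideanDomain.div_add_mod a c) - h
  have h0 : a % c - r = 0 := eq_zero_of_dvd_of_degree_lt ⟨_, h'.symm⟩
    ((degree_sub_le _ _).trans_lt (max_lt (degree_mod_lt a hc) hr))
  rw [h0] at h'
  exact (sub_eq_zero.1 ((mul_eq_zero.1 h').resolve_left hc)).symm

theorem retract_T_mul (r : k[X]) (g : SL(2, k[X])) :
    retract l (T r * g) = T (l r) * retract l g := by
  have h10 : (T r * g) 1 0 = g 1 0 := by simp [mul_apply_two]
  have h00 : (T r * g) 0 0 = g 0 0 + r * g 1 0 := by simp [mul_apply_two]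
  by_cases h : g 1 0 = 0
  · rw [retract_of_eq l g h, retract_of_eq l _ (h10.trans h)]
    have hd := g.det_coe
    rw [Matrix.det_fin_two, h, mul_zero, sub_zero] at hd
    obtain ⟨d, -, hC⟩ := Polynomial.isUnit_iff.1 (IsUnit.of_mul_eq_one _ ((mul_comm _ _).trans hd))
    have hl : l (r * C d) = l r * d := by
      rw [mul_comm, ← smul_eq_C_mul, map_smul, smul_eq_mul, mul_comm]
    apply sl_ext <;> simp [mul_apply_two, h, ← hC, hl]
  · have hq : (g 0 0 + r * g 1 0) / g 1 0 = r + g 0 0 / g 1 0 := by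
      refine div_eq_of_eq_mul_add h ?_ (degree_mod_lt (g 0 0) h)
      linear_combination -(EuclideanDomain.div_add_mod (g 0 0) (g 1 0))
    rw [retract_of_ne l g h, retract_of_ne l _ (by rwa [h10]), h10, h00, hq, map_add, T_add,
      neg_add_rev, T_add, T_neg r]
    simp only [mul_assoc, inv_mul_cancel_left]

theorem retract_diag_mul (u : kˣ) (g : SL(2, k[X])) :
    retract l (diag (Units.map (C : k →+* k[X]).toMonoidHom u) * g) = diag u * retract l g := by
  induction g using euclid_induction generalizing u with
  | h0 g h =>
    rw [retract_of_eq l g h, retract_of_eq l _ (by simp [mul_apply_two, h])]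
    have hl : l (C (u : k) * g 0 1) = u * l (g 0 1) := by
      rw [← smul_eq_C_mul, map_smul, smul_eq_mul]
    apply sl_ext <;> simp [mul_apply_two, hl, ← map_inv]
  | h1 g h ih =>
    have h10 : (diag (Units.map (C : k →+* k[X]).toMonoidHom u) * g) 1 0 =
        C ((u⁻¹ : kˣ) : k) * g 1 0 := by simp [mul_apply_two, ← map_inv]
    have h00 : (diag (Units.map (C : k →+* k[X]).toMonoidHom u) * g) 0 0 =
        C (u : k) * g 0 0 := by simp [mul_apply_two]
    have hq : C (u : k) * g 0 0 / (C ((u⁻¹ : kˣ) : k) * g 1 0) =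
        C (u : k) * C (u : k) * (g 0 0 / g 1 0) := by
      refine div_eq_of_eq_mul_add (mul_ne_zero (by simp) h) (r := C (u : k) * (g 0 0 % g 1 0)) ?_ ?_
      · have hu : C (u : k) * C ((u⁻¹ : kˣ) : k) = 1 := by rw [← C_mul, u.mul_inv, C_1]
        linear_combination -(C (u : k)) * EuclideanDomain.div_add_mod (g 0 0) (g 1 0) -
          C (u : k) * g 1 0 * (g 0 0 / g 1 0) * hu
      · rw [degree_C_mul u.ne_zero, degree_C_mul u⁻¹.ne_zero]
        exact degree_mod_lt (g 0 0) h
    have hl : ∀ x, l (C (u : k) * C (u : k) * x) = u * u * l x := by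
      intro x
      rw [← C_mul, ← smul_eq_C_mul, map_smul, smul_eq_mul]
    have hne : (diag (Units.map (C : k →+* k[X]).toMonoidHom u) * g) 1 0 ≠ 0 := by
      rw [h10]; exact mul_ne_zero (by simp) h
    have key : weyl k[X] * T (-(C (u : k) * C (u : k) * (g 0 0 / g 1 0))) *
        (diag (Units.map (C : k →+* k[X]).toMonoidHom u) * g) =
        diag (Units.map (C : k →+* k[X]).toMonoidHom u⁻¹) *
          (weyl k[X] * T (-(g 0 0 / g 1 0)) * g) := by
      have := diag_mul_T (Units.map (C : k →+* k[X]).toMonoidHom u) (-(g 0 0 / g 1 0))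
      rw [mul_neg] at this
      have e : (((Units.map (C : k →+* k[X]).toMonoidHom u) : k[X]ˣ) : k[X]) = C (u : k) := rfl
      rw [e] at this
      rw [mul_assoc (weyl k[X]), ← mul_assoc (T _), ← this, map_inv, mul_assoc (diag _),
        ← mul_assoc (weyl _), weyl_mul_diag]
      simp only [mul_assoc]
    rw [retract_of_ne l g h, retract_of_ne l _ hne, h10, h00, hq, hl, key, ih,
      ← mul_assoc (diag u), ← mul_assoc (diag u), diag_mul_T, mul_assoc (T _) (diag u),
      diag_mul_weyl_inv]
    simp only [mul_assoc]

theorem retract_neg_mul (g : SL(2, k[X])) :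
    retract l (diag (-1) * g) = diag (-1) * retract l g := by
  rw [← retract_diag_mul]
  congr 3
  ext
  simp

theorem retract_weyl_mul_of_lower_lt (g : SL(2, k[X])) (h : (g 1 0).degree < (g 0 0).degree) :
    retract l (weyl k[X] * g) = weyl k * retract l g := by
  have h0 : g 0 0 ≠ 0 := by
    rintro h'
    simp [h'] at h
  have h10 : (weyl k[X] * g) 1 0 = -g 0 0 := by simp [mul_apply_two]
  have h00 : (weyl k[X] * g) 0 0 = g 1 0 := by simp [mul_apply_two]
  have hq : g 1 0 / -g 0 0 = 0 :=
    (Polynomial.div_eq_zero_iff (neg_ne_zero.2 h0)).2 (by rwa [degree_neg])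
  rw [retract_of_ne l _ (by rw [h10]; exact neg_ne_zero.2 h0), h10, h00, hq, map_zero, neg_zero,
    T_zero, T_zero, mul_one, one_mul, ← mul_assoc, weyl_mul_weyl, retract_neg_mul, ← mul_assoc,
    weyl_inv_mul_diag]

theorem retract_weyl_mul_of_upper_lt (g : SL(2, k[X])) (h : (g 0 0).degree < (g 1 0).degree) :
    retract l (weyl k[X] * g) = weyl k * retract l g := by
  have h0 : g 1 0 ≠ 0 := by
    rintro h'
    simp [h'] at h
  rw [retract_of_ne l g h0, (Polynomial.div_eq_zero_iff h0).2 h, map_zero, neg_zero,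
    T_zero, T_zero, mul_one, one_mul, mul_inv_cancel_left]

/-- If the degrees in the first column differ, one of `g` and `weyl * g` is the next Euclidean step
of the other, up to sign. If they agree, a constant `u` cancels the leading terms, and `weyl_mul_T`
rewrites `weyl * T u` so that each remaining `weyl` meets a column of unequal degrees. As `l` fixes
constants, the same relation holds in `SL₂(k)`. -/
theorem retract_weyl_mul (h1 : l 1 = 1) (g : SL(2, k[X])) :
    retract l (weyl k[X] * g) = weyl k * retract l g := by
  rcases lt_trichotomy (g 0 0).degree (g 1 0).degree with h | h | h
  · exact retract_weyl_mul_of_upper_lt l g h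
  swap
  · exact retract_weyl_mul_of_lower_lt l g h
  have hl : ∀ a : k, l (C a) = a := by
    intro a
    rw [← mul_one (C a), ← smul_eq_C_mul, map_smul, h1, smul_eq_mul, mul_one]
  have hc : g 1 0 ≠ 0 := by
    intro h'
    rw [h', degree_zero, degree_eq_bot] at h
    have hd := g.det_coe
    rw [Matrix.det_fin_two, h, h'] at hd
    simp at hd
  have ha : g 0 0 ≠ 0 := by
    intro h'
    rw [h', degree_zero, eq_comm, degree_eq_bot] at h
    exact hc h
  obtain ⟨u, hu⟩ : ∃ u : kˣ, u * (g 1 0).leadingCoeff = (g 0 0).leadingCoeff :=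
    ⟨Units.mk0 _ (div_ne_zero (leadingCoeff_ne_zero.2 ha) (leadingCoeff_ne_zero.2 hc)),
      div_mul_cancel₀ _ (leadingCoeff_ne_zero.2 hc)⟩
  obtain ⟨g', rfl⟩ : ∃ g', g = T (C (u : k)) * g' := ⟨(T (C (u : k)))⁻¹ * g, by simp⟩
  have h10 : (T (C (u : k)) * g') 1 0 = g' 1 0 := by simp [mul_apply_two]
  have h00 : (T (C (u : k)) * g') 0 0 = g' 0 0 + C (u : k) * g' 1 0 := by simp [mul_apply_two]
  have hlt : (g' 0 0).degree < (g' 1 0).degree := by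
    have : g' 0 0 = (T (C (u : k)) * g') 0 0 - C (u : k) * (T (C (u : k)) * g') 1 0 := by
      rw [h10, h00]; ring
    rw [← h10, this, ← h]
    refine degree_sub_lt_left ?_ ha ?_
    · rw [degree_C_mul u.ne_zero, h]
    · rw [leadingCoeff_mul, leadingCoeff_C, hu]
  have hmid : ((weyl k[X] * g') 1 0).degree < ((weyl k[X] * g') 0 0).degree := by
    simpa [mul_apply_two] using hlt
  set β : k := -((u⁻¹ : kˣ) : k) with hβ
  have hmid' : ((T (C β) * (weyl k[X] * g')) 1 0).degree <
      ((T (C β) * (weyl k[X] * g')) 0 0).degree := by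
    have e1 : (T (C β) * (weyl k[X] * g')) 1 0 = (weyl k[X] * g') 1 0 := by
      simp [mul_apply_two]
    have e0 : (T (C β) * (weyl k[X] * g')) 0 0 =
        (weyl k[X] * g') 0 0 + C β * (weyl k[X] * g') 1 0 := by
      rw [mul_apply_two (T (C β))]; simp
    rw [e1, e0, degree_add_eq_left_of_degree_lt]
    · exact hmid
    · exact (degree_C_mul (by simp [hβ])).trans_lt hmid
  have hb := weyl_mul_T (Units.map (C : k →+* k[X]).toMonoidHom u)
  have e : (((Units.map (C : k →+* k[X]).toMonoidHom u) : k[X]ˣ) : k[X]) = C (u : k) := rfl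
  have e' : -((((Units.map (C : k →+* k[X]).toMonoidHom u)⁻¹ : k[X]ˣ)) : k[X]) = C β := by
    rw [← map_inv, hβ, C_neg]; rfl
  rw [e, e', ← map_inv] at hb
  rw [retract_T_mul, hl, ← mul_assoc, hb, ← mul_assoc (weyl k), weyl_mul_T u]
  simp only [mul_assoc]
  rw [retract_T_mul, retract_diag_mul, retract_weyl_mul_of_lower_lt l _ hmid', retract_T_mul,
    retract_weyl_mul_of_upper_lt l _ hlt, hl]

theorem retract_one : retract l 1 = 1 := by
  rw [retract_of_eq l 1 (by simp)]
  apply sl_ext <;> simp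

theorem retract_mul (h1 : l 1 = 1) (x g : SL(2, k[X])) :
    retract l (x * g) = retract l x * retract l g := by
  induction x using euclid_induction generalizing g with
  | h0 x h =>
    obtain ⟨u, hx⟩ := exists_C_of_lower_eq_zero x h
    generalize C ((u⁻¹ : kˣ) : k) * x 0 1 = b at hx
    have hT : retract l (T b) = T (l b) := by
      rw [← mul_one (T b), retract_T_mul, retract_one, mul_one]
    rw [hx, mul_assoc, retract_diag_mul, retract_T_mul, retract_diag_mul, hT, mul_assoc]
  | h1 x h ih =>
    have key : ∀ y, retract l (weyl k[X] * T (-(x 0 0 / x 1 0)) * y) =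
        weyl k * T (l (-(x 0 0 / x 1 0))) * retract l y := fun y => by
      rw [mul_assoc, retract_weyl_mul l h1, retract_T_mul, mul_assoc]
    have := ih g
    rw [mul_assoc, key, key, mul_assoc (_ * _)] at this
    -- The Euclidean step multiplies on the left by a known factor, so it cancels.
    exact mul_left_cancel this

/-- `retract` as a group homomorphism. -/
noncomputable def retractHom (h1 : l 1 = 1) : SL(2, k[X]) →* SL(2, k) where
  toFun := retract l
  map_one' := retract_one l
  map_mul' := retract_mul l h1

theorem retractHom_T (h1 : l 1 = 1) (r : k[X]) : retractHom l h1 (T r) = T (l r) := by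
  change retract l (T r) = _
  rw [← mul_one (T r), retract_T_mul, retract_one, mul_one]

theorem retractHom_weyl (h1 : l 1 = 1) : retractHom l h1 (weyl k[X]) = weyl k := by
  change retract l (weyl k[X]) = _
  rw [← mul_one (weyl k[X]), retract_weyl_mul l h1, retract_one, mul_one]

theorem retractHom_map_C (h1 : l 1 = 1) (g : SL(2, k)) :
    retractHom l h1 (Matrix.SpecialLinearGroup.map (n := Fin 2) (C : k →+* k[X]) g) = g := by
  have hl : ∀ a : k, l (C a) = a := by
    intro a
    rw [← mul_one (C a), ← smul_eq_C_mul, map_smul, h1, smul_eq_mul, mul_one]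
  have hm : ∀ (g : SL(2, k)) i j,
      Matrix.SpecialLinearGroup.map (n := Fin 2) (C : k →+* k[X]) g i j = C (g i j) :=
    fun g i j => rfl
  have upper : ∀ g : SL(2, k), g 1 0 = 0 →
      retractHom l h1 (Matrix.SpecialLinearGroup.map (n := Fin 2) (C : k →+* k[X]) g) = g := by
    intro g h
    refine (retract_of_eq l _ (by rw [hm, h, C_0])).trans ?_
    apply sl_ext <;> simp [h, hl]
  by_cases h : g 1 0 = 0
  · exact upper g h
  · have h' := upper (weyl k * T (-(g 0 0 / g 1 0)) * g)
      (by rw [weyl_mul_T_mul_10]; field_simp; ring)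
    have hw : Matrix.SpecialLinearGroup.map (n := Fin 2) (C : k →+* k[X]) (weyl k) = weyl k[X] := by
      apply sl_ext <;> simp [hm]
    have hT : ∀ r, Matrix.SpecialLinearGroup.map (n := Fin 2) (C : k →+* k[X]) (T r) =
        T (C r) := by
      intro r
      apply sl_ext <;> simp [hm]
    rw [map_mul, map_mul, map_mul, map_mul, hw, hT, retractHom_T, hl, retractHom_weyl] at h'
    exact mul_left_cancel h'

end Retract

/-! ### The functional attached to `f`, and coprime representatives. -/

section Functional

variable {k : Type*} [Field k]

/-- A linear functional on `k[t]` whose kernel has `(f)` as its largest ideal. -/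
theorem exists_functional (f : k[X]) (hdeg : 1 ≤ f.natDegree) (hf0 : f.eval 0 ≠ 0) :
    ∃ l : k[X] →ₗ[k] k, l 1 = 1 ∧ ∀ r, (∀ s, l (s * r) = 0) ↔ f ∣ r := by
  wlog hmon : f.Monic generalizing f
  · have hne : f ≠ 0 := by rintro rfl; simp at hf0
    have hc : f.leadingCoeff⁻¹ ≠ 0 := inv_ne_zero (leadingCoeff_ne_zero.2 hne)
    obtain ⟨l, h1, h2⟩ := this (f * C f.leadingCoeff⁻¹)
      (by rwa [natDegree_mul_C hc])
      (by rw [eval_mul, eval_C]; exact mul_ne_zero hf0 hc)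
      (monic_mul_leadingCoeff_inv hne)
    refine ⟨l, h1, fun r => (h2 r).trans ?_⟩
    have hu : IsUnit (C f.leadingCoeff⁻¹) := isUnit_C.2 (isUnit_iff_ne_zero.2 hc)
    exact hu.mul_right_dvd
  set n := f.natDegree with hn
  have hcop : IsCoprime f (X ^ (n - 1)) := by
    refine IsCoprime.pow_right ?_
    refine ((irreducible_X.coprime_iff_not_dvd).2 ?_).symm
    rwa [X_dvd_iff, coeff_zero_eq_eval_zero]
  -- The top coefficient modulo `f` vanishes on no nonzero ideal of `k[t]/(f)`. The twist by `X ^ (n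
  -- - 1)`, a unit modulo `f` since `f(0) ≠ 0`, makes `l 1 = 1`.
  refine ⟨(lcoeff k (n - 1)).comp ((modByMonicHom f).comp
    (LinearMap.mulLeft k (X ^ (n - 1) : k[X]))), ?_, fun r => ⟨fun h => ?_, fun h s => ?_⟩⟩
  · change ((X ^ (n - 1) * 1) %ₘ f).coeff (n - 1) = 1
    rw [mul_one, (modByMonic_eq_self_iff hmon).2, coeff_X_pow_self]
    rw [degree_X_pow, degree_eq_natDegree hmon.ne_zero]
    exact_mod_cast (by omega : n - 1 < f.natDegree)
  · replace h : ∀ s, ((X ^ (n - 1) * (s * r)) %ₘ f).coeff (n - 1) = 0 := h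
    refine hcop.dvd_of_dvd_mul_left ?_
    by_contra hnd
    set p := (X ^ (n - 1) * r) %ₘ f with hp
    have hp0 : p ≠ 0 := fun h0 => hnd ((modByMonic_eq_zero_iff_dvd hmon).1 h0)
    have hlt : p.natDegree < n := natDegree_modByMonic_lt _ hmon (by
      rintro rfl; simp at hn; omega)
    -- This power moves the leading term of `p` to degree `n - 1`, where no further reduction
    -- occurs.
    have hs := h (X ^ (n - 1 - p.natDegree))
    have hmod : (X ^ (n - 1) * (X ^ (n - 1 - p.natDegree) * r)) %ₘ f =
        p * X ^ (n - 1 - p.natDegree) := by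
      refine (div_modByMonic_unique (X ^ (n - 1 - p.natDegree) * ((X ^ (n - 1) * r) /ₘ f)) _ hmon
        ⟨?_, ?_⟩).2
      · linear_combination
          (X ^ (n - 1 - p.natDegree)) * modByMonic_add_div (X ^ (n - 1) * r) f
      · refine degree_lt_degree ?_
        rw [natDegree_mul_X_pow _ hp0]
        omega
    rw [hmod, coeff_mul_X_pow', if_pos (by omega),
      show n - 1 - (n - 1 - p.natDegree) = p.natDegree by omega] at hs
    exact hp0 (leadingCoeff_eq_zero.1 hs)
  · change ((X ^ (n - 1) * (s * r)) %ₘ f).coeff (n - 1) = 0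
    rw [(modByMonic_eq_zero_iff_dvd hmon).2 ((h.mul_left s).mul_left _), coeff_zero]

/-- A residue class prime to `f` contains an element prime to a given `h ≠ 0`. -/
theorem exists_isCoprime_add_mul (a f h : k[X]) (haf : IsCoprime a f) (hh : h ≠ 0) :
    ∃ m, IsCoprime (a + f * m) h := by
  classical
  set s := (UniqueFactorizationMonoid.normalizedFactors h).toFinset.filter (fun p => ¬ p ∣ a)
  have hs : ∀ p ∈ s, Irreducible p ∧ ¬ p ∣ a := fun p hp => by
    rw [Finset.mem_filter, Multiset.mem_toFinset] at hp
    exact ⟨UniqueFactorizationMonoid.irreducible_of_normalized_factor p hp.1, hp.2⟩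
  -- A prime factor of `h` then divides exactly one of `a` and `f * m`.
  refine ⟨∏ p ∈ s, p, isCoprime_of_prime_dvd (fun h' => hh h'.2) ?_⟩
  intro q hq hqa hqh
  obtain ⟨p, hp, hqp⟩ :=
    UniqueFactorizationMonoid.exists_mem_normalizedFactors_of_dvd hh hq.irreducible hqh
  by_cases hqa' : q ∣ a
  · have h2 : q ∣ f * ∏ p ∈ s, p := (dvd_add_right hqa').1 hqa
    rcases hq.dvd_or_dvd h2 with h3 | h3
    · exact hq.not_isUnit (haf.isUnit_of_dvd' hqa' h3)
    · obtain ⟨p', hp', hd⟩ := (Prime.dvd_finsetProd_iff hq _).1 h3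
      exact (hs p' hp').2
        ((hq.irreducible.associated_of_dvd (hs p' hp').1 hd).dvd_iff_dvd_left.1 hqa')
  · have hps : p ∈ s := Finset.mem_filter.2 ⟨Multiset.mem_toFinset.2 hp,
      fun hpa => hqa' (hqp.dvd.trans hpa)⟩
    have hd : q ∣ ∏ p ∈ s, p := hqp.dvd.trans (Finset.dvd_prod_of_mem (fun p => p) hps)
    exact hqa' ((dvd_add_left (hd.mul_left f)).1 hqa)

end Functional

/-! ### Consequences of containing a congruence subgroup. -/

section Noncongruence

variable {R : Type*} [CommRing R]

theorem U_eq (r : R) : U r = weyl R * T (-r) * (weyl R)⁻¹ := by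
  rw [weyl_inv_eq]
  apply sl_ext <;> simp [mul_apply_two]

theorem map_T {S : Type*} [CommRing S] (φ : R →+* S) (r : R) :
    Matrix.SpecialLinearGroup.map (n := Fin 2) φ (T r) = T (φ r) := by
  have hm : ∀ (g : SL(2, R)) i j,
      Matrix.SpecialLinearGroup.map (n := Fin 2) φ g i j = φ (g i j) := fun _ _ _ => rfl
  apply sl_ext <;> simp [hm]

theorem map_U {S : Type*} [CommRing S] (φ : R →+* S) (r : R) :
    Matrix.SpecialLinearGroup.map (n := Fin 2) φ (U r) = U (φ r) := by
  have hm : ∀ (g : SL(2, R)) i j,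
      Matrix.SpecialLinearGroup.map (n := Fin 2) φ g i j = φ (g i j) := fun _ _ _ => rfl
  apply sl_ext <;> simp [hm]

/-- Only `u * v = 1` is needed, so the relation holds modulo `𝔮` for any unit modulo `𝔮`; its two
sides then differ by an element of the congruence subgroup. -/
theorem weyl_conj_T {u v : R} (huv : u * v = 1) (r : R) :
    T u * U (-v) * T u * T r = U (-(v ^ 2 * r)) * (T u * U (-v) * T u) := by
  apply sl_ext <;> simp [mul_apply_two]
  · linear_combination (-r) * huv
  · linear_combination (-v ^ 2 * r) * huv
  · linear_combination (v * r * (u * v - 1)) * huv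

variable {k : Type*} [Field k]

/-- If the kernel of the retraction contains the congruence subgroup of level `𝔮`, then `l` is
semi-invariant under the squares of the units modulo `𝔮`. -/
theorem functional_sq_mul (l : k[X] →ₗ[k] k) (h1 : l 1 = 1) (q : Ideal k[X])
    (hq : principal q ≤ (retractHom l h1).ker) {u v : k[X]} (huv : u * v - 1 ∈ q) (r : k[X]) :
    l (v ^ 2 * r) = l v ^ 2 * l r := by
  have hU : ∀ x, retractHom l h1 (U x) = U (l x) := fun x => by
    rw [U_eq, map_mul, map_mul, map_inv, retractHom_weyl, retractHom_T, map_neg, U_eq]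
  have hrel : ∀ r, T (l u) * U (-l v) * T (l u) * T (l r) =
      U (-l (v ^ 2 * r)) * (T (l u) * U (-l v) * T (l u)) := by
    intro r
    have hmem : (T u * U (-v) * T u * T r) * (U (-(v ^ 2 * r)) * (T u * U (-v) * T u))⁻¹ ∈
        principal q := by
      rw [principal, MonoidHom.mem_ker, map_mul, map_inv, mul_inv_eq_one]
      have hm : Ideal.Quotient.mk q u * Ideal.Quotient.mk q v = 1 := by
        rw [← map_mul, ← map_one (Ideal.Quotient.mk q)]
        exact Ideal.Quotient.eq.2 huv
      simp only [map_mul, map_T, map_U, map_neg, map_pow]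
      exact weyl_conj_T hm _
    have := hq hmem
    rw [MonoidHom.mem_ker, map_mul, map_inv, mul_inv_eq_one] at this
    simpa only [map_mul, hU, retractHom_T, map_neg] using this
  -- The case `r = 1` forces `l u * l v = 1`; the other entry then yields the formula for general
  -- `r`.
  have h01 := congrArg (fun A : SL(2, k) => A 0 1) (hrel 1)
  have h11 := congrArg (fun A : SL(2, k) => A 1 1) (hrel r)
  simp [mul_apply_two] at h01 h11
  rw [h1] at h01
  have hab : l u * l v = 1 := by 
    rcases h01 with h01 | h01
    · linear_combination (-1) * h01
    · exact absurd h01 one_ne_zero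
  linear_combination -(l v) * h11 + l (v ^ 2 * r) * (l u * l v - 1) * hab

end Noncongruence

end SL2Level

/-! ### The kernel of the retraction. -/

theorem theorem4p12 {k : Type*} [Field k] (f : k[X]) (hdeg : 2 ≤ f.natDegree)
    (hf0 : f.eval 0 ≠ 0) (hf1 : f.natDegree = 2 → (derivative f).eval 0 ≠ 0) :
    ∃ N : Subgroup SL(2, k[X]),
      N.Normal ∧
      ¬ SL2Level.IsCongruence N ∧
      (N : Set SL(2, k[X])) * (SL2Level.constSL2 k : Set SL(2, k[X])) = Set.univ ∧
      SL2Level.level N = Ideal.span {f} ∧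
      ∃ W : Submodule k k[X],
        W.toAddSubgroup = SL2Level.quasiLevel N ∧ Module.finrank k (k[X] ⧸ W) = 1 := by
  obtain ⟨l, h1, hl⟩ := SL2Level.exists_functional f (by omega) hf0
  have hT : ∀ r, SL2Level.T r ∈ (SL2Level.retractHom l h1).ker ↔ l r = 0 := fun r => by
    rw [MonoidHom.mem_ker, SL2Level.retractHom_T]
    refine ⟨fun h => ?_, fun h => by rw [h, SL2Level.T_zero]⟩
    simpa using congrArg (fun A : SL(2, k) => A 0 1) h
  have hf : f ≠ 0 := by rintro rfl; simp at hf0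
  refine ⟨(SL2Level.retractHom l h1).ker, inferInstance, ?_, ?_, ?_, LinearMap.ker l, ?_, ?_⟩
  · rintro ⟨q, hq0, hq⟩
    obtain ⟨h, hhq, hh⟩ := Submodule.exists_mem_ne_zero_of_ne_bot hq0
    have hcop : IsCoprime (X : k[X]) f := by
      refine (irreducible_X.coprime_iff_not_dvd).2 ?_
      rwa [X_dvd_iff, coeff_zero_eq_eval_zero]
    obtain ⟨m, u, w, huw⟩ := SL2Level.exists_isCoprime_add_mul X f h hcop hh
    have hsq := SL2Level.functional_sq_mul l h1 q hq (u := u) (v := X + f * m) (by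
      rw [show u * (X + f * m) - 1 = -w * h by linear_combination huw]
      exact q.mul_mem_left _ hhq)
    set c := l (X + f * m)
    have hdvd : f ∣ X ^ 2 - C (c ^ 2) := by
      have : f ∣ (X + f * m) ^ 2 - C (c ^ 2) := by
        refine (hl _).1 fun s => ?_
        rw [mul_comm, sub_mul, map_sub, hsq, ← smul_eq_C_mul, map_smul, smul_eq_mul, sub_self]
      have e : (X : k[X]) ^ 2 - C (c ^ 2) =
          (X + f * m) ^ 2 - C (c ^ 2) - f * (m * (2 * X + f * m)) := by ring
      rw [e]
      exact dvd_sub this (dvd_mul_right _ _)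
    obtain ⟨g, hg⟩ := hdvd
    have hX : (X ^ 2 - C (c ^ 2) : k[X]).natDegree = 2 := natDegree_X_pow_sub_C
    have hg0 : g ≠ 0 := by rintro rfl; rw [hg] at hX; simp at hX
    rw [hg, natDegree_mul hf hg0] at hX
    obtain ⟨a, rfl⟩ : ∃ a, g = C a := natDegree_eq_zero.1 (by omega : g.natDegree = 0) |>.imp
      fun _ h => h.symm
    -- The derivative of `X ^ 2 - c ^ 2` vanishes at 0 in every characteristic.
    have hd := congrArg (fun p => (derivative p).eval 0) hg
    rw [derivative_sub, derivative_C, derivative_X_pow, derivative_mul, derivative_C] at hd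
    simp only [eval_mul, eval_X, eval_C, mul_zero,
      add_zero, sub_zero, Nat.add_one_sub_one, pow_one] at hd
    rcases mul_eq_zero.1 hd.symm with hd | hd
    · exact hf1 (by omega) hd
    · exact hg0 (by rw [hd, C_0])
  · refine Set.eq_univ_of_forall fun g => ?_
    set y := Matrix.SpecialLinearGroup.map (n := Fin 2) (C : k →+* k[X])
      (SL2Level.retractHom l h1 g)
    refine Set.mem_mul.2 ⟨g * y⁻¹, ?_, y, ⟨_, rfl⟩, by group⟩
    rw [SetLike.mem_coe, MonoidHom.mem_ker, map_mul, map_inv, SL2Level.retractHom_map_C,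
      mul_inv_cancel]
  · apply le_antisymm
    · intro r hr
      rw [Ideal.mem_span_singleton]
      refine (hl r).1 fun s => (hT _).1 (Subgroup.normalCore_le _ ?_)
      exact (SL2Level.NE2_le_iff _ _).1 (SL2Level.level_isGreatest _).1 _
        (Ideal.mul_mem_left _ s hr)
    · refine (SL2Level.level_isGreatest _).2 (Subgroup.normalClosure_le_normal ?_)
      rintro _ ⟨r, hr, rfl⟩
      refine (hT r).2 ?_
      simpa using (hl r).2 (Ideal.mem_span_singleton.1 hr) 1
  · ext r
    rw [SL2Level.quasiLevel, AddSubgroup.mem_iInf]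
    have : ∀ g, r ∈ SL2Level.quasiAmplitude (SL2Level.retractHom l h1).ker g ↔ l r = 0 :=
      fun g => by
        change g * SL2Level.T r * g⁻¹ ∈ (SL2Level.retractHom l h1).ker ↔ _
        rw [Subgroup.Normal.mem_comm_iff inferInstance, inv_mul_cancel_left, hT]
    simp only [this, forall_const]
    rfl
  · have hs : Function.Surjective l := fun a => ⟨C a, by
      rw [← mul_one (C a), ← smul_eq_C_mul, map_smul, h1, smul_eq_mul, mul_one]⟩
    rw [(l.quotKerEquivOfSurjective hs).finrank_eq, Module.finrank_self]
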